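/- Let $W=(W_t)_{t\ge 0}$ be a standard Brownian motion on a probability space $(\Omega,\mathscr A,\mathbb P)$, let $\alpha\in(-\tfrac12,0)$, $\eta>0$ and $v_0>0$ be constants, and set $$Z_t=\int_0^t \eta\sqrt{2\alpha+1}\,(t-s)^{\alpha}\,\mathrm dW_s,\qquad v_t=v_0\exp\Big(Z_t-\frac{\eta^2}{2}t^{2\alpha+1}\Big),\qquad t\ge 0,$$ where, for each $t$, the stochastic integral is the $L^2(\mathbb P)$-limit of the elementary integrals of deterministic step functions that converge to the integrand in $L^2$. Then the process $(\log v_t)_{t\ge0}$ has a modification (a process $(Y_t)_{t\ge 0}$ with $\mathbb P(Y_t=\log v_t)=1$ for every $t\ge 0$) such that, almost surely, the trajectory $t\mapsto Y_t$ is locally $\gamma$-Hölder continuous on $[0,\infty)$, i.e. $\gamma$-Hölder continuous on every compact subset of $[0,\infty)$, for every $\gamma\in(0,\alpha+\tfrac12)$. -/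

import Mathlib

open MeasureTheory ProbabilityTheory Filter Topology
open scoped NNReal ENNReal

noncomputable section

namespace RoughBergomi

/-- A deterministic step function `∑ i, c i • 1_(a i, b i]` on `[0, ∞)`, given by its data.
The intervals may overlap. -/
structure Step where
  n : ℕ
  c : Fin n → ℝ
  a : Fin n → ℝ≥0
  b : Fin n → ℝ≥0
  a_le_b : ∀ i, a i ≤ b i

/-- The function `∑ i, c i • 1_(a i, b i]` represented by a step. -/
def Step.toFun (S : Step) (s : ℝ) : ℝ :=
  ∑ i, (Set.Ioc (S.a i : ℝ) (S.b i : ℝ)).indicator (fun _ => S.c i) s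

/-- The elementary stochastic integral `∑ i, c i * (W (b i) - W (a i))` of a step. -/
def Step.integral {Ω : Type*} (S : Step) (W : ℝ≥0 → Ω → ℝ) (ω : Ω) : ℝ :=
  ∑ i, S.c i * (W (S.b i) ω - W (S.a i) ω)

/-- The random variable `I` is (a version of) the stochastic integral `∫₀^∞ f(s) dW_s` of the
deterministic function `f`: it is the `L²(P)`-limit of the elementary integrals of a sequence of
step functions which converges to `f` in `L²([0, ∞))`. By the Itô isometry this determines `I`
up to almost sure equality. -/
def IsWienerIntegral {Ω : Type*} [MeasurableSpace Ω] (P : Measure Ω) (W : ℝ≥0 → Ω → ℝ)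
    (f : ℝ → ℝ) (I : Ω → ℝ) : Prop :=
  MemLp I 2 P ∧
  ∃ S : ℕ → Step,
    Tendsto (fun n => eLpNorm (fun s => (S n).toFun s - f s) 2
      (volume.restrict (Set.Ici (0 : ℝ)))) atTop (𝓝 0) ∧
    Tendsto (fun n => eLpNorm (fun ω => (S n).integral W ω - I ω) 2 P) atTop (𝓝 0)

/-- The kernel `K_α(s, t) = η √(2α + 1) (t - s) ^ α`, for `0 ≤ s < t`. -/
def kernel (η α s t : ℝ) : ℝ := η * √(2 * α + 1) * (t - s) ^ α

/-- `Z` is a process with `Z_t = ∫₀ᵗ K_α(s, t) dW_s` for every `t ≥ 0`. -/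
def IsVolterra {Ω : Type*} [MeasurableSpace Ω] (P : Measure Ω) (W : ℝ≥0 → Ω → ℝ) (η α : ℝ)
    (Z : ℝ≥0 → Ω → ℝ) : Prop :=
  ∀ t : ℝ≥0, IsWienerIntegral P W
    ((Set.Ico (0 : ℝ) (t : ℝ)).indicator (fun s => kernel η α s (t : ℝ))) (Z t)

/-- The volatility process `v_t = v₀ exp (Z_t - η² / 2 * t ^ (2α + 1))`. -/
def vol {Ω : Type*} (v₀ η α : ℝ) (Z : ℝ≥0 → Ω → ℝ) (t : ℝ≥0) (ω : Ω) : ℝ :=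
  v₀ * Real.exp (Z t ω - η ^ 2 / 2 * (t : ℝ) ^ (2 * α + 1))

/-- `Y` is a modification of the process `X`: each `Y t` is a random variable, almost surely
equal to `X t`. -/
def IsModification {Ω : Type*} [MeasurableSpace Ω] (P : Measure Ω) (Y X : ℝ≥0 → Ω → ℝ) : Prop :=
  ∀ t, Measurable (Y t) ∧ Y t =ᵐ[P] X t

/-- `f : [0, ∞) → ℝ` is locally `γ`-Hölder continuous: it is `γ`-Hölder continuous on every
compact set. -/
def LocallyHolder (γ : ℝ≥0) (f : ℝ≥0 → ℝ) : Prop :=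
  ∀ K : Set ℝ≥0, IsCompact K → ∃ C : ℝ≥0, HolderOnWith C γ f K

end RoughBergomi

end

/-!
Since `log v_t = log v₀ + Z_t - η² t^(2α+1) / 2` and the drift is `(2α+1)`-Hölder with
`2α+1 > α+1/2`, it suffices to find a modification of `Z` with locally Hölder paths. Set
`H = α + 1/2`.

* *Kernel estimate* (`RoughBergomi.eLpNorm_cutKernel_sub_le`): the `L²` distance of the integrands
  of `Z_s` and `Z_t` is at most `√2 η |t - s|^H`. This rests on `(a - b)² ≤ a² - b²` for
  `0 ≤ b ≤ a`, which replaces the square of a difference of powers by a difference of integrable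
  powers with an explicit integral.
* *Moments* (`RoughBergomi.IsWienerIntegral.lintegral_enorm_pow_sub_le`): a difference of two
  elementary integrals is a centred Gaussian variable whose variance is the squared `L²` distance of
  the step functions, so its `p`-th absolute moment is `c_p` times the `p`-th power of that
  distance. By Fatou's lemma along an almost surely convergent subsequence, Wiener integrals inherit this as
  an upper bound, and the law of the limit need not be identified. Thus
  `E |Z_s - Z_t|^p ≤ C_p |s - t|^(pH)` for every `p`.
* *Kolmogorov–Chentsov* (`exists_modification_holder`): for each `p`, almost surely the increments
  over neighbouring dyadic numbers of level `n` are `O(2^(-n(H - 2/p)))`. Chaining along dyadic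
  approximations shows that the limits of the dyadic values define `γ`-Hölder paths as soon as
  `γ ≤ H - 2/p`. As `p` ranges over a countable set, one null set serves all `γ < H`.
-/

/-! ### Moments of elementary integrals -/

/-- The absolute moment of order `p` of the standard Gaussian law. -/
noncomputable def gaussianAbsMoment (p : ℕ) : ℝ≥0∞ := ∫⁻ x, ‖x‖ₑ ^ p ∂(gaussianReal 0 1)

theorem gaussianAbsMoment_ne_top (p : ℕ) : gaussianAbsMoment p ≠ ∞ := by
  rcases eq_or_ne p 0 with rfl | hp
  · simp [gaussianAbsMoment]
  have h := (memLp_id_gaussianReal (μ := 0) (v := 1) (p : ℝ≥0)).eLpNorm_lt_top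
  have h2 := eLpNorm_nnreal_pow_eq_lintegral (f := (id : ℝ → ℝ)) (μ := gaussianReal 0 1)
    (p := (p : ℝ≥0)) (by exact_mod_cast hp)
  simp only [NNReal.coe_natCast, ENNReal.rpow_natCast, id] at h2
  rw [gaussianAbsMoment, ← h2]
  exact (ENNReal.pow_lt_top h).ne

theorem lintegral_enorm_pow_gaussianReal (v : ℝ≥0) (p : ℕ) :
    ∫⁻ x, ‖x‖ₑ ^ p ∂(gaussianReal 0 v) = gaussianAbsMoment p * (NNReal.sqrt v : ℝ≥0∞) ^ p := by
  have hv : gaussianReal 0 v = (gaussianReal 0 1).map ((NNReal.sqrt v : ℝ) * ·) := by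
    rw [gaussianReal_map_const_mul]
    congr
    · simp
    · ext; simp
  rw [hv, lintegral_map (by fun_prop) (by fun_prop), gaussianAbsMoment,
    ← lintegral_mul_const _ (by fun_prop)]
  congr with x
  rw [enorm_mul, mul_pow, mul_comm]
  congr
  rw [Real.enorm_eq_ofReal (NNReal.coe_nonneg _), ENNReal.ofReal_coe_nnreal]

namespace ProbabilityTheory

variable {Ω : Type*} [MeasurableSpace Ω] {P : Measure Ω}
  {W : ℝ≥0 → Ω → ℝ} {ι : Type*} [Fintype ι]

theorem IsPreBrownianReal.hasGaussianLaw_sum_increments (hW : IsPreBrownianReal W P)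
    (c : ι → ℝ) (a b : ι → ℝ≥0) :
    HasGaussianLaw (fun ω => ∑ i, c i * (W (b i) ω - W (a i) ω)) P := by
  classical
  have h : IsGaussianProcess (fun (_ : Unit) ω => ∑ i, c i * (W (b i) ω - W (a i) ω)) P := by
    refine hW.isGaussianProcess.of_isGaussianProcess fun _ =>
      ⟨Finset.univ.image a ∪ Finset.univ.image b,
        ∑ i, c i • (ContinuousLinearMap.proj ⟨b i, by simp⟩ -
          ContinuousLinearMap.proj ⟨a i, by simp⟩), fun ω => ?_⟩
    simp
  exact h.hasGaussianLaw_eval ()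

theorem IsPreBrownianReal.integral_sum_increments (hW : IsPreBrownianReal W P)
    (c : ι → ℝ) (a b : ι → ℝ≥0) :
    ∫ ω, ∑ i, c i * (W (b i) ω - W (a i) ω) ∂P = 0 := by
  have hint (i) : Integrable (fun ω => c i * (W (b i) ω - W (a i) ω)) P :=
    ((hW.integrable_eval _).sub (hW.integrable_eval _)).const_mul _
  rw [integral_finsetSum _ fun i _ => hint i]
  refine Finset.sum_eq_zero fun i _ => ?_
  rw [integral_const_mul, integral_sub (hW.integrable_eval _) (hW.integrable_eval _),
    hW.integral_eval, hW.integral_eval]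
  simp

/-- The covariance of two Brownian increments is the length of the overlap of the intervals. -/
theorem IsPreBrownianReal.covariance_increments [IsProbabilityMeasure P]
    (hW : IsPreBrownianReal W P)
    {a b a' b' : ℝ≥0} (hab : a ≤ b) (hab' : a' ≤ b') :
    cov[fun ω => W b ω - W a ω, fun ω => W b' ω - W a' ω; P] =
      (volume.restrict (Set.Ici (0 : ℝ))).real (Set.Ioc (a : ℝ) b ∩ Set.Ioc (a' : ℝ) b') := by
  have hm (t) : MemLp (fun ω => W t ω) 2 P := (hW.isGaussianProcess.hasGaussianLaw_eval t).memLp_two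
  rw [covariance_fun_sub_fun_sub (hm _) (hm _) (hm _) (hm _)]
  simp_rw [hW.covariance_fun_eval]
  rw [Set.Ioc_inter_Ioc, measureReal_restrict_apply measurableSet_Ioc, Set.inter_eq_left.2,
    Real.volume_real_Ioc]
  · norm_cast at *
    push_cast
    rw [← NNReal.coe_le_coe] at hab hab'
    simp only [max_def, min_def]
    split_ifs <;> linarith
  · intro x hx
    exact (le_max_of_le_left a.2).trans hx.1.le

theorem IsPreBrownianReal.variance_sum_increments [IsProbabilityMeasure P]
    (hW : IsPreBrownianReal W P)
    (c : ι → ℝ) (a b : ι → ℝ≥0) (hab : ∀ i, a i ≤ b i) :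
    Var[fun ω => ∑ i, c i * (W (b i) ω - W (a i) ω); P] =
      ∫ s in Set.Ici (0 : ℝ),
        (∑ i, (Set.Ioc (a i : ℝ) (b i)).indicator (fun _ => c i) s) ^ 2 := by
  have hm (t) : MemLp (fun ω => W t ω) 2 P := (hW.isGaussianProcess.hasGaussianLaw_eval t).memLp_two
  have hm' (i) : MemLp (fun ω => c i * (W (b i) ω - W (a i) ω)) 2 P :=
    ((hm _).sub (hm _)).const_mul _
  rw [← covariance_self (hW.hasGaussianLaw_sum_increments c a b).aemeasurable,
    covariance_fun_sum_fun_sum hm' hm']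
  simp_rw [covariance_const_mul_left, covariance_const_mul_right,
    hW.covariance_increments (hab _) (hab _)]
  have hsq (s : ℝ) : (∑ i, (Set.Ioc (a i : ℝ) (b i)).indicator (fun _ => c i) s) ^ 2 =
      ∑ i, ∑ j, (Set.Ioc (a i : ℝ) (b i) ∩ Set.Ioc (a j : ℝ) (b j)).indicator
        (fun _ => c i * c j) s := by
    rw [sq, Finset.sum_mul_sum]
    refine Finset.sum_congr rfl fun i _ => Finset.sum_congr rfl fun j _ => ?_
    rw [Set.inter_indicator_mul]
  have hI (i j : ι) : Integrable ((Set.Ioc (a i : ℝ) (b i) ∩ Set.Ioc (a j : ℝ) (b j)).indicator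
        (fun _ => c i * c j)) (volume.restrict (Set.Ici (0 : ℝ))) := by
    refine (integrable_indicator_iff (measurableSet_Ioc.inter measurableSet_Ioc)).2 ?_
    refine integrableOn_const (ne_of_lt ?_)
    refine (measure_mono Set.inter_subset_left).trans_lt ?_
    exact (Measure.restrict_apply_le _ _).trans_lt (by simp)
  simp_rw [hsq]
  rw [integral_finsetSum _ fun i _ => integrable_finsetSum _ fun j _ => hI i j]
  refine Finset.sum_congr rfl fun i _ => ?_
  rw [integral_finsetSum _ fun j _ => hI i j]
  refine Finset.sum_congr rfl fun j _ => ?_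
  rw [integral_indicator_const _ (measurableSet_Ioc.inter measurableSet_Ioc), smul_eq_mul]
  ring

/-- **Itô isometry for all moments**: an elementary integral is centred Gaussian, so that its
`p`-th absolute moment is a constant times the `p`-th power of the `L²` norm of the integrand. -/
theorem IsPreBrownianReal.lintegral_enorm_pow_sum_increments [IsProbabilityMeasure P]
    (hW : IsPreBrownianReal W P)
    (c : ι → ℝ) (a b : ι → ℝ≥0) (hab : ∀ i, a i ≤ b i) (p : ℕ) :
    ∫⁻ ω, ‖∑ i, c i * (W (b i) ω - W (a i) ω)‖ₑ ^ p ∂P = gaussianAbsMoment p *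
      eLpNorm (fun s => ∑ i, (Set.Ioc (a i : ℝ) (b i)).indicator (fun _ => c i) s) 2
        (volume.restrict (Set.Ici (0 : ℝ))) ^ p := by
  set f : ℝ → ℝ := fun s => ∑ i, (Set.Ioc (a i : ℝ) (b i)).indicator (fun _ => c i) s with hf
  have hG := hW.hasGaussianLaw_sum_increments c a b
  have hlaw : HasLaw (fun ω => ∑ i, c i * (W (b i) ω - W (a i) ω))
      (gaussianReal 0 (∫ s in Set.Ici (0 : ℝ), f s ^ 2).toNNReal) P := by
    refine ⟨hG.aemeasurable, ?_⟩
    rw [hG.map_eq_gaussianReal, hW.integral_sum_increments,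
      hW.variance_sum_increments c a b hab]
  have hfm : MemLp f 2 (volume.restrict (Set.Ici (0 : ℝ))) := by
    refine memLp_finsetSum _ fun i _ => ?_
    refine memLp_indicator_const _ measurableSet_Ioc _ (Or.inr (ne_of_lt ?_))
    exact (Measure.restrict_apply_le _ _).trans_lt (by simp)
  rw [hlaw.lintegral_comp (f := fun x => ‖x‖ₑ ^ p) (by fun_prop),
    lintegral_enorm_pow_gaussianReal, hfm.eLpNorm_eq_integral_rpow_norm (by simp) (by simp)]
  congr 2
  have h0 : 0 ≤ ∫ s in Set.Ici (0 : ℝ), f s ^ 2 := integral_nonneg fun s => sq_nonneg _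
  rw [← ENNReal.ofReal_coe_nnreal, Real.coe_sqrt, Real.coe_toNNReal _ h0, Real.sqrt_eq_rpow]
  simp

end ProbabilityTheory

/-! ### Moments of Wiener integrals -/

namespace RoughBergomi

variable {Ω : Type*} [MeasurableSpace Ω] {P : Measure Ω}
  {W : ℝ≥0 → Ω → ℝ}

theorem Step.measurable_toFun (S : Step) : Measurable S.toFun :=
  Finset.measurable_fun_sum _ fun _ _ => measurable_const.indicator measurableSet_Ioc

theorem Step.aemeasurable_integral (hW : IsPreBrownianReal W P) (S : Step) :
    AEMeasurable (S.integral W) P :=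
  Finset.aemeasurable_fun_sum _ fun _ _ =>
    ((hW.aemeasurable _).sub (hW.aemeasurable _)).const_mul _

/-- The difference of two elementary integrals is again a weighted sum of increments, indexed by
the disjoint union of the two families of intervals. -/
theorem Step.lintegral_enorm_pow_integral_sub [IsProbabilityMeasure P]
    (hW : IsPreBrownianReal W P) (S T : Step) (p : ℕ) :
    ∫⁻ ω, ‖S.integral W ω - T.integral W ω‖ₑ ^ p ∂P = gaussianAbsMoment p *
      eLpNorm (fun s => S.toFun s - T.toFun s) 2 (volume.restrict (Set.Ici (0 : ℝ))) ^ p := by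
  have h := IsPreBrownianReal.lintegral_enorm_pow_sum_increments hW
    (Sum.elim S.c (fun j => -T.c j)) (Sum.elim S.a T.a) (Sum.elim S.b T.b)
    (by rintro (i | i); exacts [S.a_le_b i, T.a_le_b i]) p
  have hneg (j : Fin T.n) (s : ℝ) :
      (Set.Ioc (T.a j : ℝ) (T.b j)).indicator (fun _ => -T.c j) s =
        -(Set.Ioc (T.a j : ℝ) (T.b j)).indicator (fun _ => T.c j) s := by
    simp only [Set.indicator]; split_ifs <;> simp
  simp only [Fintype.sum_sum_type, Sum.elim_inl, Sum.elim_inr, hneg, neg_mul,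
    Finset.sum_neg_distrib, ← sub_eq_add_neg] at h
  exact h

/-- Fatou's lemma carries the moment bound for elementary integrals over to the limits. -/
theorem IsWienerIntegral.lintegral_enorm_pow_sub_le [IsProbabilityMeasure P]
    (hW : IsPreBrownianReal W P) {f g : ℝ → ℝ} {I J : Ω → ℝ} (hf : Measurable f) (hg : Measurable g)
    (hI : IsWienerIntegral P W f I) (hJ : IsWienerIntegral P W g J) (p : ℕ) :
    ∫⁻ ω, ‖I ω - J ω‖ₑ ^ p ∂P ≤ gaussianAbsMoment p *
      eLpNorm (fun s => f s - g s) 2 (volume.restrict (Set.Ici (0 : ℝ))) ^ p := by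
  obtain ⟨hIm, S, hSf, hSI⟩ := hI
  obtain ⟨hJm, T, hTg, hTJ⟩ := hJ
  set μ := volume.restrict (Set.Ici (0 : ℝ))
  have hS (n) : AEStronglyMeasurable ((S n).integral W) P :=
    ((S n).aemeasurable_integral hW).aestronglyMeasurable
  have hT (n) : AEStronglyMeasurable ((T n).integral W) P :=
    ((T n).aemeasurable_integral hW).aestronglyMeasurable
  -- Along a common subsequence the elementary integrals converge almost surely.
  have hlim : Tendsto (fun n => eLpNorm (((S n).integral W - (T n).integral W) - (I - J)) 2 P)
      atTop (𝓝 0) := by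
    refine tendsto_of_tendsto_of_tendsto_of_le_of_le tendsto_const_nhds
      (by simpa using hSI.add hTJ) (fun _ => zero_le) fun n => ?_
    have : ((S n).integral W - (T n).integral W) - (I - J) =
        ((S n).integral W - I) - ((T n).integral W - J) := by abel
    simp only [this]
    exact eLpNorm_sub_le ((hS n).sub hIm.1) ((hT n).sub hJm.1) (by norm_num)
  obtain ⟨ns, hns, hae⟩ := (tendstoInMeasure_of_tendsto_eLpNorm (by norm_num)
    (fun n => (hS n).sub (hT n)) (hIm.1.sub hJm.1) hlim).exists_seq_tendsto_ae
  set e : ℕ → ℝ≥0∞ := fun n => eLpNorm (fun s => (S (ns n)).toFun s - f s) 2 μ +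
    eLpNorm (fun s => f s - g s) 2 μ + eLpNorm (fun s => (T (ns n)).toFun s - g s) 2 μ with he
  have hbound (n) : ∫⁻ ω, ‖(S (ns n)).integral W ω - (T (ns n)).integral W ω‖ₑ ^ p ∂P ≤
      gaussianAbsMoment p * e n ^ p := by
    rw [Step.lintegral_enorm_pow_integral_sub hW]
    gcongr
    have hsplit : (fun s => (S (ns n)).toFun s - (T (ns n)).toFun s) =
        ((fun s => (S (ns n)).toFun s - f s) + fun s => f s - g s) -
          fun s => (T (ns n)).toFun s - g s := by
      ext s; simp
    have hSm := (S (ns n)).measurable_toFun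
    have hTm := (T (ns n)).measurable_toFun
    rw [hsplit]
    refine (eLpNorm_sub_le (by fun_prop) (by fun_prop) (by norm_num)).trans ?_
    simp only [he]
    gcongr
    exact eLpNorm_add_le (by fun_prop) (by fun_prop) (by norm_num)
  have hetend : Tendsto (fun n => gaussianAbsMoment p * e n ^ p) atTop
      (𝓝 (gaussianAbsMoment p * eLpNorm (fun s => f s - g s) 2 μ ^ p)) := by
    refine ENNReal.Tendsto.const_mul (ENNReal.Tendsto.pow ?_)
      (Or.inr (gaussianAbsMoment_ne_top p))
    simpa [he] using ((hSf.comp hns.tendsto_atTop).add_const _).add (hTg.comp hns.tendsto_atTop)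
  calc ∫⁻ ω, ‖I ω - J ω‖ₑ ^ p ∂P
      = ∫⁻ ω, liminf (fun n =>
          ‖(S (ns n)).integral W ω - (T (ns n)).integral W ω‖ₑ ^ p) atTop ∂P := by
        refine lintegral_congr_ae ?_
        filter_upwards [hae] with ω hω
        exact ((ENNReal.Tendsto.pow hω.enorm).liminf_eq).symm
    _ ≤ liminf (fun n =>
          ∫⁻ ω, ‖(S (ns n)).integral W ω - (T (ns n)).integral W ω‖ₑ ^ p ∂P) atTop := by
        refine lintegral_liminf_le' fun n => ?_
        exact (((hS _).aemeasurable.sub (hT _).aemeasurable).enorm).pow_const _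
    _ ≤ liminf (fun n => gaussianAbsMoment p * e n ^ p) atTop :=
        liminf_le_liminf (Eventually.of_forall hbound)
    _ = _ := hetend.liminf_eq

end RoughBergomi

/-! ### The Volterra kernel -/

namespace RoughBergomi

/-- The integrand of `Z_t`: the Volterra kernel cut off at time `t`. -/
noncomputable def cutKernel (η α t : ℝ) : ℝ → ℝ :=
  (Set.Ico (0 : ℝ) t).indicator fun s => kernel η α s t

theorem measurable_cutKernel (η α t : ℝ) : Measurable (cutKernel η α t) := by
  unfold cutKernel kernel
  exact Measurable.indicator (by fun_prop) measurableSet_Ico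

theorem sub_sq_le_sq_sub_sq {a b : ℝ} (hb : 0 ≤ b) (hba : b ≤ a) :
    (a - b) ^ 2 ≤ a ^ 2 - b ^ 2 := by
  nlinarith

/-- The squared `L²` distance of the kernels at times `s ≤ t`. On `[0, s]` the inequality
`(a - b)² ≤ a² - b²` for `0 ≤ b ≤ a` reduces the estimate to integrals of powers; in the resulting
sum the terms `s^(2α+1) - t^(2α+1) ≤ 0` are dropped. -/
theorem eLpNorm_cutKernel_sub_sq_le {η α : ℝ} (hα : α ∈ Set.Ioo (-1 / 2 : ℝ) 0) {s t : ℝ}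
    (hs : 0 ≤ s) (hst : s ≤ t) :
    eLpNorm (fun u => cutKernel η α s u - cutKernel η α t u) 2
      (volume.restrict (Set.Ici (0 : ℝ))) ^ 2 ≤
      ENNReal.ofReal (2 * η ^ 2 * (t - s) ^ (2 * α + 1)) := by
  obtain ⟨hα1, hα2⟩ := hα
  set β : ℝ := 2 * α + 1 with hβ
  have hβ0 : 0 < β := by linarith
  have h2α : -1 < 2 * α := by linarith
  set c : ℝ := η ^ 2 * β with hc
  have hc0 : 0 ≤ c := by positivity
  set F : ℝ → ℝ := fun u => (s - u) ^ (2 * α) - (t - u) ^ (2 * α) with hF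
  set G : ℝ → ℝ := fun u => (t - u) ^ (2 * α) with hG
  have hint (a b d : ℝ) : IntervalIntegrable (fun u => (d - u) ^ (2 * α)) volume a b := by
    have := (intervalIntegral.intervalIntegrable_rpow'
      (a := d - a) (b := d - b) h2α).comp_sub_left d
    simpa using this
  have hval (a b d : ℝ) : ∫ u in a..b, (d - u) ^ (2 * α) =
      ((d - a) ^ β - (d - b) ^ β) / β := by
    rw [intervalIntegral.integral_comp_sub_left (fun x => x ^ (2 * α)) d,
      integral_rpow (Or.inl h2α)]
  have hFi : IntervalIntegrable F volume 0 s := (hint 0 s s).sub (hint 0 s t)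
  have hGi : IntervalIntegrable G volume s t := hint s t t
  have hsq (u x : ℝ) (hu : 0 ≤ x - u) : kernel η α u x ^ 2 = c * (x - u) ^ (2 * α) := by
    rw [kernel, mul_pow, mul_pow, Real.sq_sqrt hβ0.le, ← Real.rpow_natCast ((x - u) ^ α),
      ← Real.rpow_mul hu, hc]
    push_cast
    rw [mul_comm α 2]
  -- `B` dominates the squared difference pointwise; its integral is explicit.
  set B : ℝ → ℝ := fun u => (Set.Ico 0 s).indicator (fun u => c * F u) u +
    (Set.Ico s t).indicator (fun u => c * G u) u with hB
  have hpt (u : ℝ) : (cutKernel η α s u - cutKernel η α t u) ^ 2 ≤ B u := by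
    rcases lt_or_ge u 0 with hu | hu
    · have h1 : u ∉ Set.Ico 0 s := fun h => by linarith [h.1]
      have h2 : u ∉ Set.Ico 0 t := fun h => by linarith [h.1]
      have h4 : u ∉ Set.Ico s t := fun h => by linarith [h.1]
      simp [cutKernel, hB, h1, h2, h4]
    rcases lt_or_ge u s with hus | hus
    · have h1 : u ∈ Set.Ico 0 s := ⟨hu, hus⟩
      have h2 : u ∈ Set.Ico 0 t := ⟨hu, by linarith⟩
      have h4 : u ∉ Set.Ico s t := fun h => by linarith [h.1]
      simp only [cutKernel, hB, Set.indicator_of_mem h1, Set.indicator_of_mem h2,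
        Set.indicator_of_notMem h4, add_zero, hF]
      have hle : (t - u) ^ α ≤ (s - u) ^ α :=
        Real.rpow_le_rpow_of_nonpos (by linarith) (by linarith) hα2.le
      have e : (kernel η α u s - kernel η α u t) ^ 2 =
          c * ((s - u) ^ α - (t - u) ^ α) ^ 2 := by
        rw [kernel, kernel, ← mul_sub, mul_pow, mul_pow, Real.sq_sqrt hβ0.le]
      have e2 (x : ℝ) (hx : 0 ≤ x) : x ^ (2 * α) = (x ^ α) ^ 2 := by
        rw [← Real.rpow_natCast, ← Real.rpow_mul hx, mul_comm]; norm_cast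
      rw [e, e2 _ (by linarith), e2 _ (by linarith)]
      gcongr
      exact sub_sq_le_sq_sub_sq (Real.rpow_nonneg (by linarith) _) hle
    · have h1 : u ∉ Set.Ico 0 s := fun h => by linarith [h.2]
      by_cases hut : u < t
      · have h2 : u ∈ Set.Ico 0 t := ⟨hu, hut⟩
        have h4 : u ∈ Set.Ico s t := ⟨hus, hut⟩
        simp only [cutKernel, hB, Set.indicator_of_notMem h1, Set.indicator_of_mem h2,
          Set.indicator_of_mem h4, zero_add, zero_sub, neg_sq, hG]
        exact (hsq u t (by linarith)).le
      · have h2 : u ∉ Set.Ico 0 t := fun h => hut h.2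
        have h4 : u ∉ Set.Ico s t := fun h => hut h.2
        simp [cutKernel, hB, h1, h2, h4]
  have hFi' : Integrable ((Set.Ico 0 s).indicator fun u => c * F u) := by
    rw [integrable_indicator_iff measurableSet_Ico, integrableOn_Ico_iff_integrableOn_Ioo,
      ← integrableOn_Ioc_iff_integrableOn_Ioo,
      ← intervalIntegrable_iff_integrableOn_Ioc_of_le hs]
    exact hFi.const_mul c
  have hGi' : Integrable ((Set.Ico s t).indicator fun u => c * G u) := by
    rw [integrable_indicator_iff measurableSet_Ico, integrableOn_Ico_iff_integrableOn_Ioo,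
      ← integrableOn_Ioc_iff_integrableOn_Ioo,
      ← intervalIntegrable_iff_integrableOn_Ioc_of_le hst]
    exact hGi.const_mul c
  have hBint : ∫ u, B u ≤ 2 * η ^ 2 * (t - s) ^ β := by
    rw [hB, integral_add hFi' hGi', integral_indicator measurableSet_Ico,
      integral_indicator measurableSet_Ico, integral_Ico_eq_integral_Ioo,
      integral_Ico_eq_integral_Ioo, ← integral_Ioc_eq_integral_Ioo,
      ← integral_Ioc_eq_integral_Ioo, ← intervalIntegral.integral_of_le hs,
      ← intervalIntegral.integral_of_le hst,
      intervalIntegral.integral_const_mul, intervalIntegral.integral_const_mul,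
      intervalIntegral.integral_sub (hint _ _ _) (hint _ _ _), hval, hval, hval]
    have hle : s ^ β ≤ t ^ β := Real.rpow_le_rpow hs hst hβ0.le
    simp only [sub_self, sub_zero, Real.zero_rpow hβ0.ne', hc]
    have : η ^ 2 * β * (s ^ β / β - (t ^ β - (t - s) ^ β) / β) + η ^ 2 * β * ((t - s) ^ β / β) =
        2 * η ^ 2 * (t - s) ^ β - η ^ 2 * (t ^ β - s ^ β) := by
      field_simp
      ring
    rw [this]
    have := mul_nonneg (sq_nonneg η) (sub_nonneg.2 hle)
    linarith
  have hB0 : 0 ≤ B := fun u => (sq_nonneg _).trans (hpt u)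
  have h2 := eLpNorm_nnreal_pow_eq_lintegral (p := 2) (μ := volume.restrict (Set.Ici (0 : ℝ)))
    (f := fun u => cutKernel η α s u - cutKernel η α t u) (by norm_num)
  simp only [NNReal.coe_ofNat, ENNReal.coe_ofNat, ENNReal.rpow_ofNat] at h2
  rw [h2]
  refine (setLIntegral_le_lintegral _ _).trans ?_
  calc ∫⁻ u, ‖cutKernel η α s u - cutKernel η α t u‖ₑ ^ 2
      ≤ ∫⁻ u, ENNReal.ofReal (B u) := by
        refine lintegral_mono fun u => ?_
        rw [← ofReal_norm, ← ENNReal.ofReal_pow (norm_nonneg _), Real.norm_eq_abs, sq_abs]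
        exact ENNReal.ofReal_le_ofReal (hpt u)
    _ = ENNReal.ofReal (∫ u, B u) :=
        (ofReal_integral_eq_lintegral_ofReal (hFi'.add hGi')
          (Eventually.of_forall hB0)).symm
    _ ≤ _ := ENNReal.ofReal_le_ofReal hBint

end RoughBergomi

/-! ### Dyadic chaining -/

/-- The largest dyadic number of level `n`, i.e. multiple of `2⁻ⁿ`, which is at most `t`. -/
noncomputable def dyadicFloor (t : ℝ≥0) (n : ℕ) : ℝ≥0 := (⌊t * 2 ^ n⌋₊ : ℝ≥0) / 2 ^ n

theorem floor_mul_two_pow_succ (t : ℝ≥0) (n : ℕ) :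
    ⌊t * 2 ^ (n + 1)⌋₊ = 2 * ⌊t * 2 ^ n⌋₊ ∨ ⌊t * 2 ^ (n + 1)⌋₊ = 2 * ⌊t * 2 ^ n⌋₊ + 1 := by
  rw [show t * 2 ^ (n + 1) = 2 * (t * 2 ^ n) by ring]
  generalize t * 2 ^ n = x
  have h1 := Nat.floor_le (zero_le : 0 ≤ x)
  have h2 := Nat.lt_floor_add_one x
  have h3 := Nat.floor_le (zero_le : 0 ≤ 2 * x)
  have h4 := Nat.lt_floor_add_one (2 * x)
  generalize ⌊x⌋₊ = k at *
  generalize ⌊2 * x⌋₊ = m at *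
  rw [← NNReal.coe_le_coe] at h1 h3
  rw [← NNReal.coe_lt_coe] at h2 h4
  push_cast at *
  have a1 : (m : ℝ) < 2 * k + 2 := by linarith
  have a2 : (2 * k : ℝ) < m + 1 := by linarith
  norm_cast at a1 a2
  omega

theorem dist_dyadicFloor_le (t : ℝ≥0) (n : ℕ) : dist t (dyadicFloor t n) ≤ (1 / 2 : ℝ) ^ n := by
  have h1 := Nat.floor_le (zero_le : 0 ≤ t * 2 ^ n)
  have h2 := (Nat.lt_floor_add_one (t * 2 ^ n)).le
  rw [← NNReal.coe_le_coe] at h1 h2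
  push_cast at h1 h2
  have hp : (0 : ℝ) < 2 ^ n := by positivity
  rw [NNReal.dist_eq, dyadicFloor, abs_le]
  push_cast
  have h3 : ((⌊t * 2 ^ n⌋₊ : ℝ) / 2 ^ n) ≤ t := by rwa [div_le_iff₀ hp]
  have h4 : (t : ℝ) ≤ (⌊t * 2 ^ n⌋₊ : ℝ) / 2 ^ n + 1 / 2 ^ n := by
    rwa [← add_div, le_div_iff₀ hp]
  rw [one_div_pow]
  constructor
  · have : (0 : ℝ) ≤ 1 / 2 ^ n := by positivity
    linarith
  · linarith

theorem floor_mul_two_pow_lt {t : ℝ≥0} {N : ℕ} (ht : t < N) (n : ℕ) :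
    ⌊t * 2 ^ n⌋₊ < N * 2 ^ n := by
  rw [Nat.floor_lt zero_le]
  push_cast
  gcongr

section Chaining

variable {f : ℝ≥0 → ℝ} {N : ℕ} {γ K : ℝ}

theorem dist_dyadicFloor_succ_le (hK0 : 0 ≤ K)
    (hK : ∀ n k : ℕ, k < N * 2 ^ n →
      dist (f ((k : ℝ≥0) / 2 ^ n)) (f ((k + 1 : ℕ) / 2 ^ n)) ≤ K * ((1 / 2 : ℝ) ^ γ) ^ n)
    {t : ℝ≥0} (ht : t < N) (n : ℕ) :
    dist (f (dyadicFloor t n)) (f (dyadicFloor t (n + 1))) ≤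
      K * ((1 / 2 : ℝ) ^ γ) ^ (n + 1) := by
  have e : dyadicFloor t n = ((2 * ⌊t * 2 ^ n⌋₊ : ℕ) : ℝ≥0) / 2 ^ (n + 1) := by
    rw [dyadicFloor, pow_succ]
    push_cast
    field_simp
  have hlt := floor_mul_two_pow_lt ht (n + 1)
  rw [e]
  rcases floor_mul_two_pow_succ t n with h | h <;> rw [dyadicFloor, h]
  · rw [dist_self]; positivity
  · exact hK (n + 1) _ (by omega)

theorem dist_dyadicFloor_le_of_dist_le (hK0 : 0 ≤ K)
    (hK : ∀ n k : ℕ, k < N * 2 ^ n →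
      dist (f ((k : ℝ≥0) / 2 ^ n)) (f ((k + 1 : ℕ) / 2 ^ n)) ≤ K * ((1 / 2 : ℝ) ^ γ) ^ n)
    {s t : ℝ≥0} (hst : s ≤ t) (ht : t < N) {n : ℕ} (hn : dist s t ≤ (1 / 2 : ℝ) ^ n) :
    dist (f (dyadicFloor s n)) (f (dyadicFloor t n)) ≤ K * ((1 / 2 : ℝ) ^ γ) ^ n := by
  have hle : ⌊s * 2 ^ n⌋₊ ≤ ⌊t * 2 ^ n⌋₊ := Nat.floor_mono (by gcongr)
  have hle' : ⌊t * 2 ^ n⌋₊ ≤ ⌊s * 2 ^ n⌋₊ + 1 := by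
    rw [← Nat.floor_add_one zero_le]
    refine Nat.floor_mono ?_
    rw [← NNReal.coe_le_coe] at *
    rw [NNReal.dist_eq, abs_sub_comm, abs_of_nonneg (by linarith), one_div_pow,
      le_div_iff₀ (by positivity)] at hn
    push_cast
    linarith
  have hlt := floor_mul_two_pow_lt ht n
  rw [dyadicFloor, dyadicFloor]
  obtain h | h : ⌊t * 2 ^ n⌋₊ = ⌊s * 2 ^ n⌋₊ ∨ ⌊t * 2 ^ n⌋₊ = ⌊s * 2 ^ n⌋₊ + 1 := by omega
  · rw [h, dist_self]; positivity
  · rw [h]; exact hK n _ (by omega)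

/-- **Dyadic chaining**: if the increments of `f` between neighbouring dyadic numbers of each level
`n` are at most `K 2^(-γ n)`, then the limits of `f` along dyadic approximations from below define
a `γ`-Hölder function on `[0, N)`. -/
theorem exists_dist_le_of_dyadic_increments (hγ : 0 < γ) (hK0 : 0 ≤ K)
    (hK : ∀ n k : ℕ, k < N * 2 ^ n →
      dist (f ((k : ℝ≥0) / 2 ^ n)) (f ((k + 1 : ℕ) / 2 ^ n)) ≤ K * ((1 / 2 : ℝ) ^ γ) ^ n)
    {g : ℝ≥0 → ℝ}
    (hg : ∀ t, g t = limsup (fun n => f (dyadicFloor t n)) atTop) :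
    ∃ C : ℝ, 0 ≤ C ∧ ∀ s < (N : ℝ≥0), ∀ t < (N : ℝ≥0), dist (g s) (g t) ≤ C * dist s t ^ γ := by
  set r : ℝ := (1 / 2 : ℝ) ^ γ with hr
  have hr0 : 0 < r := by positivity
  have hr1 : r < 1 := Real.rpow_lt_one (by norm_num) (by norm_num) hγ
  have hstep {t : ℝ≥0} (ht : t < N) (n : ℕ) :
      dist (f (dyadicFloor t n)) (f (dyadicFloor t (n + 1))) ≤ K * r ^ n := by
    refine (dist_dyadicFloor_succ_le hK0 hK ht n).trans ?_
    rw [← hr, pow_succ]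
    have : r ^ n * r ≤ r ^ n := mul_le_of_le_one_right (by positivity) hr1.le
    gcongr
  have hlim {t : ℝ≥0} (ht : t < N) : Tendsto (fun n => f (dyadicFloor t n)) atTop (𝓝 (g t)) := by
    obtain ⟨y, hy⟩ := cauchySeq_tendsto_of_complete
      (cauchySeq_of_le_geometric r K hr1 (hstep ht))
    rwa [hg t, hy.limsup_eq]
  set D : ℝ := K / (1 - r) with hD
  have hD0 : 0 ≤ D := div_nonneg hK0 (by linarith)
  have hdist {t : ℝ≥0} (ht : t < N) (n : ℕ) : dist (f (dyadicFloor t n)) (g t) ≤ D * r ^ n :=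
    (dist_le_of_le_geometric_of_tendsto r K hr1 (hstep ht) (hlim ht) n).trans_eq (by rw [hD]; ring)
  set M : ℝ := ∑ k ∈ Finset.range N, |f k| with hM
  have hM0 : 0 ≤ M := Finset.sum_nonneg fun _ _ => abs_nonneg _
  have hfM {t : ℝ≥0} (ht : t < N) : |f (dyadicFloor t 0)| ≤ M := by
    have := floor_mul_two_pow_lt ht 0
    have e : dyadicFloor t 0 = ((⌊t * 2 ^ 0⌋₊ : ℕ) : ℝ≥0) := by simp [dyadicFloor]
    rw [e]
    exact Finset.single_le_sum (f := fun k : ℕ => |f k|) (fun _ _ => abs_nonneg _)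
      (Finset.mem_range.2 (by simpa using this))
  -- The first part of the constant serves points at distance at most `1`, the second part those at
  -- larger distance, where the values at integer points have to be compared.
  refine ⟨(2 * D + K) / r + (2 * D + 2 * M), by positivity, ?_⟩
  -- By symmetry it is enough to treat `s ≤ t`.
  suffices H : ∀ s t : ℝ≥0, s ≤ t → t < N →
      dist (g s) (g t) ≤ ((2 * D + K) / r + (2 * D + 2 * M)) * dist s t ^ γ by
    intro s hs t ht
    rcases le_total s t with h | h
    · exact H s t h ht
    · rw [dist_comm, dist_comm s]; exact H t s h hs
  intro s t hst ht
  have hs := hst.trans_lt ht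
  have htri (n : ℕ) : dist (g s) (g t) ≤
      2 * D * r ^ n + dist (f (dyadicFloor s n)) (f (dyadicFloor t n)) := by
    have h1 := hdist hs n
    have h2 := hdist ht n
    have h3 := dist_triangle4 (g s) (f (dyadicFloor s n)) (f (dyadicFloor t n)) (g t)
    rw [dist_comm (g s) (f _)] at h3
    linarith
  rcases eq_or_lt_of_le hst with rfl | hlt
  · simp [Real.zero_rpow hγ.ne']
  have hd : 0 < dist s t := dist_pos.2 hlt.ne
  have hdγ : 0 ≤ dist s t ^ γ := by positivity
  rcases le_or_gt (dist s t) 1 with h1 | h1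
  · obtain ⟨n, hn1, hn2⟩ := exists_nat_pow_near_of_lt_one hd h1
      (by norm_num : (0 : ℝ) < 1 / 2) (by norm_num)
    have hrn : r ^ n ≤ dist s t ^ γ / r := by
      rw [le_div_iff₀ hr0, ← pow_succ, hr, ← Real.rpow_natCast, ← Real.rpow_mul (by norm_num),
        mul_comm, Real.rpow_mul (by norm_num), Real.rpow_natCast]
      gcongr
    -- `n` is the dyadic scale of `dist s t`, so the level-`n` floors are equal or adjacent.
    calc dist (g s) (g t)
        ≤ 2 * D * r ^ n + K * r ^ n :=
          (htri n).trans (by gcongr; exact dist_dyadicFloor_le_of_dist_le hK0 hK hst ht hn2)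
      _ = (2 * D + K) * r ^ n := by ring
      _ ≤ (2 * D + K) * (dist s t ^ γ / r) := by gcongr
      _ = (2 * D + K) / r * dist s t ^ γ := by ring
      _ ≤ _ := by gcongr; linarith
  · have h2 : 1 ≤ dist s t ^ γ := Real.one_le_rpow h1.le hγ.le
    have h3 : dist (f (dyadicFloor s 0)) (f (dyadicFloor t 0)) ≤ 2 * M := by
      rw [Real.dist_eq]
      have := abs_sub (f (dyadicFloor s 0)) (f (dyadicFloor t 0))
      linarith [hfM hs, hfM ht]
    have h4 : 0 ≤ (2 * D + K) / r := by positivity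
    calc dist (g s) (g t) ≤ 2 * D + 2 * M := by
          have := htri 0
          rw [pow_zero, mul_one] at this
          linarith
      _ ≤ (2 * D + K) / r + (2 * D + 2 * M) := by linarith
      _ ≤ _ := le_mul_of_one_le_right (by positivity) h2

end Chaining

/-! ### The Kolmogorov–Chentsov theorem -/

section KolmogorovChentsov

variable {Ω : Type*} [MeasurableSpace Ω] {P : Measure Ω} {X : ℝ≥0 → Ω → ℝ} {H : ℝ}

theorem edist_dyadic_succ (n k : ℕ) :
    edist ((k : ℝ≥0) / 2 ^ n) (((k + 1 : ℕ) : ℝ≥0) / 2 ^ n) = (1 / 2 : ℝ≥0∞) ^ n := by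
  have h : dist ((k : ℝ≥0) / 2 ^ n) (((k + 1 : ℕ) : ℝ≥0) / 2 ^ n) = (1 / 2 : ℝ) ^ n := by
    have e : (k : ℝ) / 2 ^ n - ((k + 1 : ℕ) : ℝ) / 2 ^ n = -(1 / 2) ^ n := by
      push_cast
      rw [one_div_pow]
      ring
    rw [NNReal.dist_eq]
    push_cast at e ⊢
    rw [e, abs_neg, abs_of_pos (by positivity)]
  rw [edist_dist, h, ENNReal.ofReal_pow (by norm_num), ENNReal.ofReal_div_of_pos (by norm_num)]
  simp

/-- Almost surely the increments over neighbouring dyadic numbers are of order `2^(-γ n)` for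
every `γ < H - 1 / p`; the slightly worse exponent `γ = H - 2 / p` makes the sum of the
expectations over all levels a geometric series of ratio `1 / 2`. -/
theorem ae_exists_bound_dyadic_increments (hX : ∀ t, AEMeasurable (X t) P) {p : ℕ} (hp : p ≠ 0)
    {C : ℝ≥0}
    (hmom : ∀ s t, ∫⁻ ω, ‖X s ω - X t ω‖ₑ ^ p ∂P ≤ C * edist s t ^ (p * H)) (N : ℕ) :
    ∀ᵐ ω ∂P, ∃ K : ℝ, 0 ≤ K ∧ ∀ n k : ℕ, k < N * 2 ^ n →
      dist (X ((k : ℝ≥0) / 2 ^ n) ω) (X ((k + 1 : ℕ) / 2 ^ n) ω) ≤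
        K * ((1 / 2 : ℝ) ^ (H - 2 / p)) ^ n := by
  have hhalf0 : (1 / 2 : ℝ≥0∞) ≠ 0 := by simp
  have hhalft : (1 / 2 : ℝ≥0∞) ≠ ∞ := by simp
  set ρ : ℝ≥0∞ := (1 / 2 : ℝ≥0∞) ^ (H - 2 / p) with hρ
  have hρ0 : ρ ≠ 0 := by simp [hρ]
  have hρt : ρ ≠ ∞ := by simp [hρ, ENNReal.rpow_eq_top_iff]
  have hρn0 (n : ℕ) : ρ ^ n ≠ 0 := pow_ne_zero _ hρ0
  have hρnt (n : ℕ) : ρ ^ n ≠ ∞ := ENNReal.pow_ne_top hρt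
  set Δ : ℕ → ℕ → Ω → ℝ := fun n k ω => X ((k : ℝ≥0) / 2 ^ n) ω - X ((k + 1 : ℕ) / 2 ^ n) ω
  have hΔ (n k) : AEMeasurable (Δ n k) P := (hX _).sub (hX _)
  have hterm (n k) : ∫⁻ ω, (‖Δ n k ω‖ₑ / ρ ^ n) ^ p ∂P ≤ C * (1 / 4) ^ n := by
    have hpow : ((1 / 2 : ℝ≥0∞) ^ n) ^ ((p : ℝ) * H) = (1 / 4) ^ n * (ρ ^ n) ^ p := by
      have h4 : (1 / 4 : ℝ≥0∞) = (1 / 2) ^ (2 : ℝ) := by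
        rw [ENNReal.rpow_ofNat]
        simp only [one_div]
        rw [← ENNReal.inv_pow]; norm_num
      rw [hρ, h4]
      simp only [← ENNReal.rpow_natCast, ← ENNReal.rpow_mul]
      rw [← ENNReal.rpow_add _ _ hhalf0 hhalft]
      congr 1
      have : (p : ℝ) ≠ 0 := by exact_mod_cast hp
      field_simp
      ring
    calc ∫⁻ ω, (‖Δ n k ω‖ₑ / ρ ^ n) ^ p ∂P
        = (∫⁻ ω, ‖Δ n k ω‖ₑ ^ p ∂P) / (ρ ^ n) ^ p := by
          simp_rw [div_eq_mul_inv, mul_pow]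
          rw [lintegral_mul_const'' _ ((hΔ n k).enorm.pow_const _), ← ENNReal.inv_pow]
      _ ≤ C * ((1 / 4) ^ n * (ρ ^ n) ^ p) / (ρ ^ n) ^ p := by
          gcongr
          rw [← hpow, ← edist_dyadic_succ n k]
          exact hmom _ _
      _ = C * (1 / 4) ^ n := by
          rw [← mul_assoc, ENNReal.mul_div_cancel_right (pow_ne_zero _ (hρn0 n))
            (ENNReal.pow_ne_top (hρnt n))]
  set S : Ω → ℝ≥0∞ := fun ω => ∑' n, ∑ k ∈ Finset.range (N * 2 ^ n), (‖Δ n k ω‖ₑ / ρ ^ n) ^ p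
    with hS
  have hmeas (n k) : AEMeasurable (fun ω => (‖Δ n k ω‖ₑ / ρ ^ n) ^ p) P :=
    ((hΔ n k).enorm.div_const _).pow_const _
  have hmeas' (n) : AEMeasurable
      (fun ω => ∑ k ∈ Finset.range (N * 2 ^ n), (‖Δ n k ω‖ₑ / ρ ^ n) ^ p) P :=
    Finset.aemeasurable_fun_sum _ fun k _ => hmeas n k
  have hSint : ∫⁻ ω, S ω ∂P ≠ ∞ := by
    have hle : ∫⁻ ω, S ω ∂P ≤ ∑' n : ℕ, N * C * (1 / 2 : ℝ≥0∞) ^ n := by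
      rw [hS, lintegral_tsum hmeas']
      refine ENNReal.tsum_le_tsum fun n => ?_
      rw [lintegral_finsetSum' _ fun k _ => hmeas n k]
      refine (Finset.sum_le_card_nsmul _ _ _ fun k _ => hterm n k).trans_eq ?_
      have h2 : (2 : ℝ≥0∞) * (1 / 4) = 1 / 2 := by
        rw [show (4 : ℝ≥0∞) = 2 * 2 by norm_num, one_div, one_div,
          ENNReal.mul_inv (by simp) (by simp), ← mul_assoc, ENNReal.mul_inv_cancel (by simp)
          (by simp), one_mul]
      rw [Finset.card_range, nsmul_eq_mul, ← h2, mul_pow]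
      push_cast
      ring
    refine ne_top_of_le_ne_top ?_ hle
    rw [ENNReal.tsum_mul_left, ENNReal.tsum_geometric]
    refine ENNReal.mul_ne_top (by finiteness) ?_
    simp
  filter_upwards [ae_lt_top' (AEMeasurable.tsum hmeas') hSint] with ω hω
  refine ⟨(S ω + 1).toReal, ENNReal.toReal_nonneg, fun n k hk => ?_⟩
  have h1 : (‖Δ n k ω‖ₑ / ρ ^ n) ^ p ≤ S ω :=
    (Finset.single_le_sum (f := fun k => (‖Δ n k ω‖ₑ / ρ ^ n) ^ p) (fun _ _ => zero_le)
      (Finset.mem_range.2 hk)).trans (ENNReal.le_tsum (f := fun n =>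
        ∑ k ∈ Finset.range (N * 2 ^ n), (‖Δ n k ω‖ₑ / ρ ^ n) ^ p) n)
  have h2 : ‖Δ n k ω‖ₑ / ρ ^ n ≤ S ω + 1 := by
    rcases le_total (‖Δ n k ω‖ₑ / ρ ^ n) 1 with h | h
    · exact h.trans le_add_self
    · exact ((le_self_pow₀ h hp).trans h1).trans le_self_add
  have h3 : ‖Δ n k ω‖ₑ ≤ (S ω + 1) * ρ ^ n := by
    rwa [ENNReal.div_le_iff (hρn0 n) (hρnt n)] at h2
  have h4 := ENNReal.toReal_mono (ENNReal.mul_ne_top (by finiteness) (hρnt n)) h3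
  rw [toReal_enorm, ENNReal.toReal_mul, ENNReal.toReal_pow, hρ, ← ENNReal.toReal_rpow] at h4
  simpa [dist_eq_norm, Δ] using h4

theorem ae_tendsto_dyadicFloor (hX : ∀ t, AEMeasurable (X t) P) {p : ℕ} (hp : p ≠ 0)
    (hH : 0 < H) {C : ℝ≥0}
    (hmom : ∀ s t, ∫⁻ ω, ‖X s ω - X t ω‖ₑ ^ p ∂P ≤ C * edist s t ^ (p * H)) (t : ℝ≥0) :
    ∀ᵐ ω ∂P, Tendsto (fun n => X (dyadicFloor t n) ω) atTop (𝓝 (X t ω)) := by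
  have hp' : (0 : ℝ) < p := by exact_mod_cast Nat.pos_of_ne_zero hp
  have hmeas (n) : AEMeasurable (fun ω => ‖X (dyadicFloor t n) ω - X t ω‖ₑ ^ p) P :=
    ((hX _).sub (hX _)).enorm.pow_const _
  set r : ℝ≥0∞ := (1 / 2 : ℝ≥0∞) ^ (p * H) with hr
  have hr1 : r < 1 := ENNReal.rpow_lt_one (by simp) (by positivity)
  have hint : ∫⁻ ω, ∑' n, ‖X (dyadicFloor t n) ω - X t ω‖ₑ ^ p ∂P ≠ ∞ := by
    have hle : ∫⁻ ω, ∑' n, ‖X (dyadicFloor t n) ω - X t ω‖ₑ ^ p ∂P ≤ ∑' n : ℕ, C * r ^ n := by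
      rw [lintegral_tsum hmeas]
      refine ENNReal.tsum_le_tsum fun n => (hmom _ _).trans ?_
      gcongr
      have hrn : r ^ n = ((1 / 2 : ℝ≥0∞) ^ n) ^ (p * H) := by
        rw [hr, ← ENNReal.rpow_natCast, ← ENNReal.rpow_natCast, ← ENNReal.rpow_mul,
          ← ENNReal.rpow_mul, mul_comm]
      rw [hrn, edist_comm, edist_dist]
      refine ENNReal.rpow_le_rpow ?_ (by positivity)
      refine (ENNReal.ofReal_le_ofReal (dist_dyadicFloor_le t n)).trans_eq ?_
      rw [ENNReal.ofReal_pow (by norm_num), ENNReal.ofReal_div_of_pos (by norm_num)]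
      simp
    refine ne_top_of_le_ne_top ?_ hle
    rw [ENNReal.tsum_mul_left, ENNReal.tsum_geometric]
    refine ENNReal.mul_ne_top (by finiteness) (ENNReal.inv_ne_top.2 ?_)
    exact (tsub_pos_of_lt hr1).ne'
  filter_upwards [ae_lt_top' (AEMeasurable.tsum hmeas) hint] with ω hω
  have h := ENNReal.tendsto_atTop_zero_of_tsum_ne_top hω.ne
  have h2 := ((ENNReal.continuous_rpow_const (y := (1 / p : ℝ))).tendsto 0).comp h
  rw [ENNReal.zero_rpow_of_pos (by positivity)] at h2
  rw [tendsto_iff_edist_tendsto_0]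
  refine h2.congr fun n => ?_
  rw [Function.comp_apply, ← ENNReal.rpow_natCast, ← ENNReal.rpow_mul,
    mul_one_div_cancel hp'.ne', ENNReal.rpow_one, edist_eq_enorm_sub]

/-- **Kolmogorov–Chentsov**: a process on `[0, ∞)` whose increments satisfy the moment bounds
`E |X_s - X_t| ^ p ≤ C_p |s - t| ^ (p H)` for all `p` has a modification whose paths are locally
`γ`-Hölder continuous for all `γ < H` simultaneously, i.e. `γ`-Hölder on each `[0, N)`. -/
theorem exists_modification_holder (hX : ∀ t, AEMeasurable (X t) P) (hH : 0 < H)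
    (hmom : ∀ p : ℕ, ∃ C : ℝ≥0, ∀ s t,
      ∫⁻ ω, ‖X s ω - X t ω‖ₑ ^ p ∂P ≤ C * edist s t ^ (p * H)) :
    ∃ Y : ℝ≥0 → Ω → ℝ, RoughBergomi.IsModification P Y X ∧
      ∀ᵐ ω ∂P, ∀ γ : ℝ≥0, 0 < γ → (γ : ℝ) < H →
        ∀ N : ℕ, ∃ C : ℝ, 0 ≤ C ∧ ∀ s < (N : ℝ≥0), ∀ t < (N : ℝ≥0),
          dist (Y s ω) (Y t ω) ≤ C * dist s t ^ (γ : ℝ) := by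
  set X' : ℝ≥0 → Ω → ℝ := fun t => (hX t).mk with hX'
  have hX'm (t) : Measurable (X' t) := (hX t).measurable_mk
  have hXX' (t) : X t =ᵐ[P] X' t := (hX t).ae_eq_mk
  have hmom' (p : ℕ) : ∃ C : ℝ≥0, ∀ s t,
      ∫⁻ ω, ‖X' s ω - X' t ω‖ₑ ^ p ∂P ≤ C * edist s t ^ (p * H) := by
    obtain ⟨C, hC⟩ := hmom p
    refine ⟨C, fun s t => le_of_eq_of_le (lintegral_congr_ae ?_) (hC s t)⟩
    filter_upwards [hXX' s, hXX' t] with ω h1 h2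
    rw [h1, h2]
  -- On the null set where the dyadic values do not converge, `limsup` is a junk value, but it is
  -- measurable in `ω` throughout.
  refine ⟨fun t ω => limsup (fun n => X' (dyadicFloor t n) ω) atTop, fun t => ⟨?_, ?_⟩, ?_⟩
  · exact Measurable.limsup fun n => hX'm _
  · obtain ⟨C, hC⟩ := hmom' 1
    filter_upwards [hXX' t,
      ae_tendsto_dyadicFloor (fun t => (hX'm t).aemeasurable) one_ne_zero hH hC t] with ω h1 h2
    rw [h1, h2.limsup_eq]
  · have hae : ∀ᵐ ω ∂P, ∀ p : ℕ, p ≠ 0 → ∀ N : ℕ, ∃ K : ℝ, 0 ≤ K ∧ ∀ n k : ℕ, k < N * 2 ^ n →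
        dist (X' ((k : ℝ≥0) / 2 ^ n) ω) (X' ((k + 1 : ℕ) / 2 ^ n) ω) ≤
          K * ((1 / 2 : ℝ) ^ (H - 2 / p)) ^ n := by
      refine ae_all_iff.2 fun p => ?_
      by_cases hp : p = 0
      · exact Eventually.of_forall fun ω h => absurd hp h
      obtain ⟨C, hC⟩ := hmom' p
      filter_upwards [ae_all_iff.2 fun N => ae_exists_bound_dyadic_increments
        (fun t => (hX'm t).aemeasurable) hp hC N] with ω hω _ using hω
    filter_upwards [hae] with ω hω γ hγ hγH N
    -- Choose `p` so large that `γ ≤ H - 2 / p`.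
    obtain ⟨p, hp⟩ := exists_nat_gt (2 / (H - γ))
    have hd : 0 < H - γ := sub_pos.2 hγH
    have hp0 : (0 : ℝ) < p := (by positivity : 0 < 2 / (H - γ)).trans hp
    have hγp : (γ : ℝ) ≤ H - 2 / p := by
      rw [div_lt_iff₀ hd] at hp
      have : 2 / (p : ℝ) ≤ H - γ := by rw [div_le_iff₀ hp0]; linarith
      linarith
    obtain ⟨K, hK0, hK⟩ := hω p (by exact_mod_cast hp0.ne') N
    refine exists_dist_le_of_dyadic_increments (f := fun t => X' t ω) (K := K)
      (NNReal.coe_pos.2 hγ) hK0 (fun n k hk => (hK n k hk).trans ?_) fun t => rfl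
    have : (1 / 2 : ℝ) ^ (H - 2 / p) ≤ (1 / 2 : ℝ) ^ (γ : ℝ) :=
      Real.rpow_le_rpow_of_exponent_ge (by norm_num) (by norm_num) hγp
    gcongr

end KolmogorovChentsov

/-! ### The log-volatility process -/

namespace RoughBergomi

theorem eLpNorm_cutKernel_sub_le {η α : ℝ} (hα : α ∈ Set.Ioo (-1 / 2 : ℝ) 0) (s t : ℝ≥0) :
    eLpNorm (fun u => cutKernel η α s u - cutKernel η α t u) 2
      (volume.restrict (Set.Ici (0 : ℝ))) ≤
      ENNReal.ofReal (√2 * |η|) * edist s t ^ (α + 1 / 2) := by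
  wlog hst : s ≤ t generalizing s t
  · rw [edist_comm]
    refine (eLpNorm_congr_norm_ae (Eventually.of_forall fun u => ?_)).trans_le
      (this t s (le_of_not_ge hst))
    exact norm_sub_rev _ _
  have hH : 0 < α + 1 / 2 := by linarith [hα.1]
  have hst' : (0 : ℝ) ≤ t - s := sub_nonneg.2 (by exact_mod_cast hst)
  have hd : edist s t = ENNReal.ofReal (t - s) := by
    rw [edist_dist, NNReal.dist_eq, abs_sub_comm, abs_of_nonneg hst']
  rw [← ENNReal.pow_le_pow_left_iff two_ne_zero]
  refine (eLpNorm_cutKernel_sub_sq_le hα s.2 hst).trans_eq ?_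
  rw [hd, ENNReal.ofReal_rpow_of_nonneg hst' hH.le, ← ENNReal.ofReal_mul (by positivity),
    ← ENNReal.ofReal_pow (by positivity), mul_pow, mul_pow, Real.sq_sqrt (by norm_num), sq_abs,
    ← Real.rpow_natCast ((_ : ℝ) ^ _), ← Real.rpow_mul hst']
  congr 3
  push_cast
  ring

theorem IsVolterra.lintegral_enorm_pow_sub_le {Ω : Type*} [MeasurableSpace Ω] {P : Measure Ω}
    [IsProbabilityMeasure P] {W : ℝ≥0 → Ω → ℝ} (hW : IsPreBrownianReal W P) {η α : ℝ}
    (hα : α ∈ Set.Ioo (-1 / 2 : ℝ) 0) {Z : ℝ≥0 → Ω → ℝ} (hZ : IsVolterra P W η α Z) (p : ℕ) :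
    ∃ C : ℝ≥0, ∀ s t,
      ∫⁻ ω, ‖Z s ω - Z t ω‖ₑ ^ p ∂P ≤ C * edist s t ^ (p * (α + 1 / 2)) := by
  refine ⟨(gaussianAbsMoment p).toNNReal * (√2 * |η|).toNNReal ^ p, fun s t => ?_⟩
  refine ((hZ s).lintegral_enorm_pow_sub_le hW (measurable_cutKernel η α s)
    (measurable_cutKernel η α t) (hZ t) p).trans ?_
  rw [mul_comm (p : ℝ), ENNReal.rpow_mul, ENNReal.rpow_natCast, ENNReal.coe_mul,
    ENNReal.coe_toNNReal (gaussianAbsMoment_ne_top p), ENNReal.coe_pow, mul_assoc, ← mul_pow]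
  gcongr
  exact eLpNorm_cutKernel_sub_le hα s t

theorem abs_rpow_sub_rpow_le {β : ℝ} (h0 : 0 ≤ β) (h1 : β ≤ 1) (s t : ℝ≥0) :
    |(s : ℝ) ^ β - (t : ℝ) ^ β| ≤ dist s t ^ β := by
  wlog hst : s ≤ t generalizing s t
  · rw [abs_sub_comm, dist_comm]
    exact this t s (le_of_not_ge hst)
  have hst' : (s : ℝ) ≤ t := hst
  have h := Real.rpow_add_le_add_rpow s.coe_nonneg (sub_nonneg.2 hst') h0 h1
  rw [add_sub_cancel] at h
  have h2 : (s : ℝ) ^ β ≤ (t : ℝ) ^ β := Real.rpow_le_rpow s.coe_nonneg hst' h0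
  rw [NNReal.dist_eq, abs_sub_comm, abs_sub_comm (s : ℝ), abs_of_nonneg (sub_nonneg.2 h2),
    abs_of_nonneg (sub_nonneg.2 hst')]
  linarith

theorem locallyHolder_of_dist_le {γ : ℝ≥0} {f : ℝ≥0 → ℝ}
    (h : ∀ N : ℕ, ∃ C : ℝ, 0 ≤ C ∧ ∀ s < (N : ℝ≥0), ∀ t < (N : ℝ≥0),
      dist (f s) (f t) ≤ C * dist s t ^ (γ : ℝ)) : LocallyHolder γ f := by
  intro K hK
  obtain ⟨M, hM⟩ := hK.bddAbove
  obtain ⟨N, hN⟩ := exists_nat_gt M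
  obtain ⟨C, hC0, hC⟩ := h N
  refine ⟨C.toNNReal, fun s hs t ht => ?_⟩
  rw [edist_dist, edist_dist, ENNReal.ofReal_rpow_of_nonneg dist_nonneg γ.coe_nonneg]
  change _ ≤ ENNReal.ofReal C * _
  rw [← ENNReal.ofReal_mul hC0]
  refine ENNReal.ofReal_le_ofReal ?_
  exact hC s ((hM hs).trans_lt hN) t ((hM ht).trans_lt hN)

theorem log_vol {Ω : Type*} {v₀ : ℝ} (hv₀ : 0 < v₀) (η α : ℝ) (Z : ℝ≥0 → Ω → ℝ) (t : ℝ≥0)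
    (ω : Ω) :
    Real.log (vol v₀ η α Z t ω) = Real.log v₀ + (Z t ω - η ^ 2 / 2 * (t : ℝ) ^ (2 * α + 1)) := by
  rw [vol, Real.log_mul hv₀.ne' (Real.exp_pos _).ne', Real.log_exp]

end RoughBergomi

theorem proposition2p3 {Ω : Type*} [MeasurableSpace Ω] (P : Measure Ω) [IsProbabilityMeasure P]
    (W : ℝ≥0 → Ω → ℝ) (hW : IsBrownianReal W P)
    (α η v₀ : ℝ) (hα : α ∈ Set.Ioo (-1 / 2 : ℝ) 0) (hη : 0 < η) (hv₀ : 0 < v₀)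
    (Z : ℝ≥0 → Ω → ℝ) (hZ : RoughBergomi.IsVolterra P W η α Z) :
    ∃ Y : ℝ≥0 → Ω → ℝ,
      RoughBergomi.IsModification P Y (fun t ω => Real.log (RoughBergomi.vol v₀ η α Z t ω)) ∧
      ∀ᵐ ω ∂P, ∀ γ : ℝ≥0, 0 < γ → (γ : ℝ) < α + 1 / 2 →
        RoughBergomi.LocallyHolder γ (fun t => Y t ω) := by
  obtain ⟨hα1, hα2⟩ := hα
  have hH : 0 < α + 1 / 2 := by linarith
  obtain ⟨Y, hY, hYH⟩ := exists_modification_holder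
    (fun t => (hZ t).1.1.aemeasurable) hH
    (RoughBergomi.IsVolterra.lintegral_enorm_pow_sub_le hW.toIsPreBrownianReal ⟨hα1, hα2⟩ hZ)
  refine ⟨fun t ω => Real.log v₀ + (Y t ω - η ^ 2 / 2 * (t : ℝ) ^ (2 * α + 1)),
    fun t => ⟨((hY t).1.sub_const _).const_add _, ?_⟩, ?_⟩
  · filter_upwards [(hY t).2] with ω hω
    rw [RoughBergomi.log_vol hv₀, hω]
  filter_upwards [hYH] with ω hω γ hγ0 hγ
  refine RoughBergomi.locallyHolder_of_dist_le fun N => ?_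
  obtain ⟨C, hC0, hC⟩ := hω γ hγ0 hγ N
  have hβγ : 0 ≤ 2 * α + 1 - γ := by linarith
  -- On `[0, N)` the `(2α+1)`-Hölder drift is `γ`-Hölder with an additional factor `N^(2α+1-γ)`.
  refine ⟨C + η ^ 2 / 2 * (N : ℝ) ^ (2 * α + 1 - γ), by positivity, fun s hs t ht => ?_⟩
  have hdrift : |(s : ℝ) ^ (2 * α + 1) - (t : ℝ) ^ (2 * α + 1)| ≤
      (N : ℝ) ^ (2 * α + 1 - γ) * dist s t ^ (γ : ℝ) := by
    refine (RoughBergomi.abs_rpow_sub_rpow_le (by linarith) (by linarith) s t).trans ?_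
    rcases eq_or_ne s t with rfl | hst
    · rw [dist_self, Real.zero_rpow (by linarith : 2 * α + 1 ≠ 0)]
      positivity
    · have hd : 0 < dist s t := dist_pos.2 hst
      have hdN : dist s t ≤ N := by
        have hs' : (s : ℝ) < N := by exact_mod_cast hs
        have ht' : (t : ℝ) < N := by exact_mod_cast ht
        rw [NNReal.dist_eq, abs_le]
        constructor <;> linarith [s.2, t.2]
      rw [show 2 * α + 1 = (2 * α + 1 - γ) + γ by ring, Real.rpow_add hd, add_sub_cancel_right]
      gcongr
  rw [Real.dist_eq, show Real.log v₀ + (Y s ω - η ^ 2 / 2 * (s : ℝ) ^ (2 * α + 1)) -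
    (Real.log v₀ + (Y t ω - η ^ 2 / 2 * (t : ℝ) ^ (2 * α + 1))) = (Y s ω - Y t ω) -
      η ^ 2 / 2 * ((s : ℝ) ^ (2 * α + 1) - (t : ℝ) ^ (2 * α + 1)) by ring]
  refine (abs_sub _ _).trans ?_
  rw [abs_mul, abs_of_nonneg (by positivity : 0 ≤ η ^ 2 / 2), add_mul, mul_assoc]
  gcongr
  exact hC s hs t ht
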